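/- Comparison-based model. The elements of a stream $\pi=(x_1,\dots,x_n)$ come from a totally ordered universe $\mathcal U$ with at least $n$ elements. The memory of a (possibly randomized) one-pass comparison-based algorithm at time $t$ is a pair $(\mathcal M_t, I_t)$, where $\mathcal M_t$ is a set of stream elements, $\mathcal M_0=\emptyset$, $\mathcal M_{t+1}\subseteq \mathcal M_t\cup\{x_{t+1}\}$, and $I_t$ is auxiliary information of unlimited size. The algorithm does not see the values of elements; what it does on the arrival of $x_{t+1}$ may depend only on its random seed, on $I_t$, on the arrival positions of the stored elements, and on the outcomes of comparisons among the elements of $\mathcal M_t\cup\{x_{t+1}\}$. Its answer to a query $y\in\mathcal U$, given at the end of the stream, may depend only on its random seed, on $I_n$, on the arrival positions of the stored elements, and on the outcomes of comparisons among $\mathcal M_n\cup\{y\}$. Its space at time $t$ is $|\mathcal M_t|$, the number of distinct stored elements. The algorithm may depend on $n$ and on $\mathcal U$. Top-$R$ quantiles problem. For $y\in\mathcal U$ let $\mathrm{rank}_\pi(y)=|\{i\in[n] : x_i<y\}|$. An algorithm solves the top-$R$ quantiles problem with error parameter $\epsilon$ and failure probability at most $\delta$ if for every stream $\pi\in\mathcal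 U^n$ and every query $y\in\mathcal U$ with $\mathrm{rank}_\pi(y)\le R$, it outputs an estimate $\widehat{\mathrm{rank}}_\pi(y)\in\mathbb R$ such that, over its internal randomness, $$\Pr\left[\,\left|\mathrm{rank}_\pi(y)-\widehat{\mathrm{rank}}_\pi(y)\right|>\epsilon R\,\right]\le\delta .$$ Lemma. Let $R=\log_2 n$ and $\epsilon=1/\sqrt{\log_2 n}$. Any comparison-based (possibly randomized) algorithm that solves the top-$R$ quantiles problem on streams of length $n$ with error parameter $\epsilon$ and failure probability at most $\delta<0.1$ needs $\Omega(\log n)$ space. Precisely: there are absolute constants $c>0$ and $N$ such that, for every $n\ge N$, every universe $\mathcal U$ with at least $n$ elements and every such algorithm, there are a stream $\pi\in\mathcal U^n$ and a time $t\le n$ with $\mathbb E\left[|\mathcal M_t|\right]\ge c\log_2 n$, the expectation being over the internal randomness of the algorithm on the fixed stream $\pi$ (in particular, some run of the algorithm stores at least $c\log_2 n$ elements at time $t$). -/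

import Mathlib

open MeasureTheory

/-- A deterministic one-pass comparison-based streaming algorithm for streams of length `n`.
Stream elements are referred to by their arrival positions in `Fin n`, and the algorithm never sees
their values.  The memory is a pair `(M, I)`: a set `M` of stored stream elements, and auxiliary
information `I : Info`, on which no bound whatsoever is imposed.

* `step I t M v`: the element at position `t` arrives while the memory is `(M, I)`; `v` holds the
  outcomes of all comparisons inside `M ∪ {t}` (`none` for any other pair).  The result is the new
  auxiliary information and the set of elements that the algorithm wants to store.
* `estimate I M v q`: the answer to a query after the stream has ended; `v` holds the outcomes of
  all comparisons inside `M`, and `q` those of the elements of `M` with the query point. -/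
structure ComparisonAlgorithm (n : ℕ) (Info : Type*) where
  init : Info
  step : Info → Fin n → Finset (Fin n) → (Fin n → Fin n → Option Ordering) →
    Info × Finset (Fin n)
  estimate : Info → Finset (Fin n) → (Fin n → Fin n → Option Ordering) →
    (Fin n → Option Ordering) → ℝ

/-- The outcomes of the comparisons between the elements of the stream `x` whose positions lie in
`S`; nothing is revealed about elements outside `S`. -/
def comparisons {n : ℕ} {U : Type*} [LinearOrder U] (x : Fin n → U) (S : Finset (Fin n)) :
    Fin n → Fin n → Option Ordering :=
  fun i j => if i ∈ S ∧ j ∈ S then some (cmp (x i) (x j)) else none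

/-- The outcomes of the comparisons between the elements of the stream `x` whose positions lie in
`S` and the query point `y`. -/
def queryComparisons {n : ℕ} {U : Type*} [LinearOrder U] (x : Fin n → U) (S : Finset (Fin n))
    (y : U) : Fin n → Option Ordering :=
  fun i => if i ∈ S then some (cmp (x i) y) else none

/-- `streamRank x y` is the number of positions `i` of the stream `x` with `x i < y`. -/
def streamRank {n : ℕ} {U : Type*} [LinearOrder U] (x : Fin n → U) (y : U) : ℕ :=
  (Finset.univ.filter fun i => x i < y).card

namespace ComparisonAlgorithm

variable {n : ℕ} {Info : Type*} {U : Type*} [LinearOrder U]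

/-- The memory `(I, M)` after the first `t` elements of the stream `x` have been read (after the
whole stream if `n ≤ t`).  An element can be stored only if it was stored before or has just
arrived; in particular a discarded element never comes back. -/
def state (A : ComparisonAlgorithm n Info) (x : Fin n → U) : ℕ → Info × Finset (Fin n)
  | 0 => (A.init, ∅)
  | t + 1 =>
    let s := A.state x t
    if h : t < n then
      let avail := insert ⟨t, h⟩ s.2
      let r := A.step s.1 ⟨t, h⟩ s.2 (comparisons x avail)
      (r.1, r.2 ∩ avail)
    else s

/-- The positions of the elements stored after the first `t` elements of `x` have been read. -/
def memory (A : ComparisonAlgorithm n Info) (x : Fin n → U) (t : ℕ) : Finset (Fin n) :=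
  (A.state x t).2

/-- The space used after the first `t` elements of `x` have been read: the number of distinct
elements of the universe that are stored (several stored copies of one element count once). -/
def space (A : ComparisonAlgorithm n Info) (x : Fin n → U) (t : ℕ) : ℕ :=
  ((A.memory x t).image x).card

/-- The estimate of `streamRank x y` that is returned for the query `y` after the whole stream `x`. -/
def answer (A : ComparisonAlgorithm n Info) (x : Fin n → U) (y : U) : ℝ :=
  A.estimate (A.state x n).1 (A.memory x n) (comparisons x (A.memory x n))
    (queryComparisons x (A.memory x n) y)

end ComparisonAlgorithm

/-- A randomized algorithm is a family `A ω` of deterministic ones, indexed by a random seed `ω`.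
It is measurable over the universe `U` if its stored set and its answer are random variables,
for each fixed stream and query. -/
structure IsMeasurableAlgorithm {n : ℕ} {Info Ω : Type*} [MeasurableSpace Ω]
    (A : Ω → ComparisonAlgorithm n Info) (U : Type*) [LinearOrder U] : Prop where
  memory : ∀ (x : Fin n → U) (t : ℕ) (S : Finset (Fin n)),
    MeasurableSet {ω | (A ω).memory x t = S}
  answer : ∀ (x : Fin n → U) (y : U), Measurable fun ω => (A ω).answer x y

/-- The randomized algorithm `A` solves the top-`R` quantiles problem over the universe `U`, with
error parameter `ε` and failure probability at most `δ`: for every stream `x` of length `n` and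
every query `y` of rank at most `R`, the answer is off by more than `ε * R` with probability at
most `δ`. -/
def SolvesTopQuantiles {n : ℕ} {Info Ω : Type*} [MeasurableSpace Ω] (P : Measure Ω)
    (A : Ω → ComparisonAlgorithm n Info) (U : Type*) [LinearOrder U] (R ε δ : ℝ) : Prop :=
  ∀ (x : Fin n → U) (y : U), (streamRank x y : ℝ) ≤ R →
    P.real {ω | ε * R < |(streamRank x y : ℝ) - (A ω).answer x y|} ≤ δ

/-- The base-4 digit that records how the path to the leaf `l` turns at height `i`: it goes to the
first half (`3`), or to the second half, which lies above (`2`) or below (`0`) the node, according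
to whether the node belongs to `b`. -/
def pathDigit (b : Finset (ℕ × ℕ)) (l i : ℕ) : ℕ :=
  if l.testBit i then (if (i, l / 2 ^ (i + 1)) ∈ b then 2 else 0) else 3

/-- The digits of the node of height `h` above the leaf `l`. -/
def nodeDigit (b : Finset (ℕ × ℕ)) (h l i : ℕ) : ℕ :=
  if i < h then 0 else if i = h then 1 else pathDigit b l i

/-- The value, below `4 ^ k`, of the node of height `h` above the leaf `l`. -/
def nodeKey (k : ℕ) (b : Finset (ℕ × ℕ)) (h l : ℕ) : ℕ :=
  ∑ i ∈ Finset.range k, nodeDigit b h l i * 4 ^ i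

theorem sum_digits_lt {d : ℕ → ℕ} (hd : ∀ i, d i < 4) (k : ℕ) :
    ∑ i ∈ Finset.range k, d i * 4 ^ i < 4 ^ k := by
  induction k with
  | zero => simp
  | succ k ih =>
    rw [Finset.sum_range_succ, pow_succ]
    have := hd k
    have h2 : d k * 4 ^ k ≤ 3 * 4 ^ k := Nat.mul_le_mul_right _ (by omega)
    omega

theorem sum_digits_lt_sum_digits {d e : ℕ → ℕ} (hd : ∀ i, d i < 4) {k h : ℕ} (hk : h < k)
    (hde : ∀ i, h < i → d i = e i) (hlt : d h < e h) :
    ∑ i ∈ Finset.range k, d i * 4 ^ i < ∑ i ∈ Finset.range k, e i * 4 ^ i := by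
  induction k with
  | zero => omega
  | succ k ih =>
    rw [Finset.sum_range_succ, Finset.sum_range_succ]
    rcases Nat.lt_succ_iff_lt_or_eq.mp hk with h1 | rfl
    · rw [hde k h1]
      exact Nat.add_lt_add_right (ih h1) _
    · have h1 := sum_digits_lt hd h
      have h2 : (d h + 1) * 4 ^ h ≤ e h * 4 ^ h := Nat.mul_le_mul_right _ hlt
      rw [add_mul, one_mul] at h2
      omega

theorem pathDigit_lt (b : Finset (ℕ × ℕ)) (l i : ℕ) : pathDigit b l i < 4 := by
  unfold pathDigit; split_ifs <;> omega

theorem nodeDigit_lt (b : Finset (ℕ × ℕ)) (h l i : ℕ) : nodeDigit b h l i < 4 := by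
  unfold nodeDigit
  have := pathDigit_lt b l i
  split_ifs <;> omega

theorem nodeKey_lt (k : ℕ) (b : Finset (ℕ × ℕ)) (h l : ℕ) : nodeKey k b h l < 4 ^ k :=
  sum_digits_lt (nodeDigit_lt b h l) k

theorem div_two_pow_congr {l l' i j : ℕ} (hij : i ≤ j) (h : l / 2 ^ i = l' / 2 ^ i) :
    l / 2 ^ j = l' / 2 ^ j := by
  obtain ⟨c, rfl⟩ := Nat.exists_eq_add_of_le hij
  rw [pow_add, ← Nat.div_div_eq_div_mul, ← Nat.div_div_eq_div_mul, h]

theorem testBit_congr {l l' i j : ℕ} (hij : i ≤ j) (h : l / 2 ^ i = l' / 2 ^ i) :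
    l.testBit j = l'.testBit j := by
  have := div_two_pow_congr hij h
  simp only [Nat.testBit_eq_decide_div_mod_eq, this]

theorem pathDigit_congr (b : Finset (ℕ × ℕ)) {l l' i j : ℕ} (hij : i < j)
    (h : l / 2 ^ (i + 1) = l' / 2 ^ (i + 1)) : pathDigit b l j = pathDigit b l' j := by
  unfold pathDigit
  rw [testBit_congr hij h, div_two_pow_congr (by omega : i + 1 ≤ j + 1) h]

theorem nodeKey_congr (k : ℕ) (b : Finset (ℕ × ℕ)) {h l l' : ℕ}
    (hl : l / 2 ^ (h + 1) = l' / 2 ^ (h + 1)) : nodeKey k b h l = nodeKey k b h l' := by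
  refine Finset.sum_congr rfl fun i _ => ?_
  unfold nodeDigit
  split_ifs with h1 h2
  · rfl
  · rfl
  · rw [pathDigit_congr b (by omega : h < i) hl]

/-- At the height where two paths part, the one that takes the second half is the smaller. -/
theorem nodeKey_lt_of_diverge (b : Finset (ℕ × ℕ)) {k h h' l l' i : ℕ} (hi : i < k) (h1 : h < i)
    (h2 : h' < i) (hl : l / 2 ^ (i + 1) = l' / 2 ^ (i + 1)) (hb : l.testBit i = true)
    (hb' : l'.testBit i = false) : nodeKey k b h l < nodeKey k b h' l' := by
  refine sum_digits_lt_sum_digits (nodeDigit_lt b h l) hi (fun j hj => ?_) ?_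
  · rw [nodeDigit, nodeDigit, if_neg (by omega), if_neg (by omega), if_neg (by omega),
      if_neg (by omega), pathDigit_congr b hj hl]
  · rw [nodeDigit, nodeDigit, if_neg (by omega), if_neg (by omega), if_neg (by omega),
      if_neg (by omega), pathDigit, pathDigit, if_pos hb, hb']
    split_ifs <;> simp_all

theorem nodeKey_lt_descendant (b : Finset (ℕ × ℕ)) {k h h' l l' : ℕ} (hk : h < k) (h1 : h' < h)
    (hl : l / 2 ^ (h + 1) = l' / 2 ^ (h + 1))
    (hb : l'.testBit h = false ∨ (h, l' / 2 ^ (h + 1)) ∈ b) :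
    nodeKey k b h l < nodeKey k b h' l' := by
  refine sum_digits_lt_sum_digits (nodeDigit_lt b h l) hk (fun j hj => ?_) ?_
  · rw [nodeDigit, nodeDigit, if_neg (by omega), if_neg (by omega), if_neg (by omega),
      if_neg (by omega), pathDigit_congr b hj hl]
  · rw [nodeDigit, nodeDigit, if_neg (by omega), if_pos rfl, if_neg (by omega),
      if_neg (by omega), pathDigit]
    rcases hb with hb | hb
    · simp [hb]
    · rw [if_pos hb]; split_ifs <;> omega

theorem descendant_lt_nodeKey (b : Finset (ℕ × ℕ)) {k h h' l l' : ℕ} (hk : h < k) (h1 : h' < h)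
    (hl : l / 2 ^ (h + 1) = l' / 2 ^ (h + 1)) (hb : l'.testBit h = true)
    (hb' : (h, l' / 2 ^ (h + 1)) ∉ b) : nodeKey k b h' l' < nodeKey k b h l := by
  refine sum_digits_lt_sum_digits (nodeDigit_lt b h' l') hk (fun j hj => ?_) ?_
  · rw [nodeDigit, nodeDigit, if_neg (by omega), if_neg (by omega), if_neg (by omega),
      if_neg (by omega), pathDigit_congr b hj hl]
  · rw [nodeDigit, nodeDigit, if_neg (by omega), if_neg (by omega), if_neg (by omega),
      if_pos rfl, pathDigit, if_pos hb, if_neg hb']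
    omega

theorem exists_diverge {k l l' : ℕ} (hl : l < 2 ^ k) (hl' : l' < 2 ^ k) (h : ℕ) :
    l / 2 ^ (h + 1) = l' / 2 ^ (h + 1) ∨
      ∃ i, h < i ∧ i < k ∧ l / 2 ^ (i + 1) = l' / 2 ^ (i + 1) ∧ l.testBit i ≠ l'.testBit i := by
  classical
  by_contra! H
  obtain ⟨H1, H2⟩ := H
  have hkh : h < k := by
    by_contra! hkh
    have h3 : 2 ^ k ≤ 2 ^ (h + 1) := Nat.pow_le_pow_right (by omega) (by omega)
    exact H1 (by rw [Nat.div_eq_of_lt (hl.trans_le h3), Nat.div_eq_of_lt (hl'.trans_le h3)])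
  have key : ∀ j, l / 2 ^ (k - j) = l' / 2 ^ (k - j) ∨ k - j ≤ h := by
    intro j
    induction j with
    | zero => left; simp [Nat.div_eq_of_lt hl, Nat.div_eq_of_lt hl']
    | succ j ih =>
      by_cases hj : k - (j + 1) ≤ h
      · exact Or.inr hj
      left
      have h3 : k - j = k - (j + 1) + 1 := by omega
      have h4 : l / 2 ^ (k - (j + 1) + 1) = l' / 2 ^ (k - (j + 1) + 1) := by
        rw [← h3]; exact ih.resolve_right (by omega)
      have h5 := H2 (k - (j + 1)) (by omega) (by omega) h4
      rw [Nat.testBit_eq_decide_div_mod_eq, Nat.testBit_eq_decide_div_mod_eq,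
        decide_eq_decide] at h5
      rw [pow_succ, ← Nat.div_div_eq_div_mul, ← Nat.div_div_eq_div_mul] at h4
      omega
  rcases key (k - (h + 1)) with h3 | h3
  · exact H1 (div_two_pow_congr (by omega) h3) |>.elim
  · omega

theorem cmp_nodeKey_of_le {b b' : Finset (ℕ × ℕ)} {k h h' l l' : ℕ} (hk : h < k) (hh : h' ≤ h)
    (hl : l < 2 ^ k) (hl' : l' < 2 ^ k)
    (H : h' < h → l / 2 ^ (h + 1) = l' / 2 ^ (h + 1) → l'.testBit h = true →
      ((h, l' / 2 ^ (h + 1)) ∈ b ↔ (h, l' / 2 ^ (h + 1)) ∈ b')) :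
    cmp (nodeKey k b h l) (nodeKey k b h' l') = cmp (nodeKey k b' h l) (nodeKey k b' h' l') := by
  rcases exists_diverge hl hl' h with h1 | ⟨i, h1, h2, h3, h4⟩
  · rcases hh.lt_or_eq with h2 | rfl
    · by_cases h3 : l'.testBit h = false ∨ (h, l' / 2 ^ (h + 1)) ∈ b
      · have h4 : l'.testBit h = false ∨ (h, l' / 2 ^ (h + 1)) ∈ b' := by
          cases h5 : l'.testBit h
          · simp
          · exact Or.inr ((H h2 h1 h5).1 (h3.resolve_left (by simp [h5])))
        rw [(cmp_eq_lt_iff _ _).2 (nodeKey_lt_descendant b hk h2 h1 h3),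
          (cmp_eq_lt_iff _ _).2 (nodeKey_lt_descendant b' hk h2 h1 h4)]
      · rw [not_or, Bool.not_eq_false] at h3
        rw [(cmp_eq_gt_iff _ _).2 (descendant_lt_nodeKey b hk h2 h1 h3.1 h3.2),
          (cmp_eq_gt_iff _ _).2 (descendant_lt_nodeKey b' hk h2 h1 h3.1
            (fun h5 => h3.2 ((H h2 h1 h3.1).2 h5)))]
    · rw [(cmp_eq_eq_iff _ _).2 (nodeKey_congr k b h1), (cmp_eq_eq_iff _ _).2 (nodeKey_congr k b' h1)]
  · cases h5 : l.testBit i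
    · have h6 : l'.testBit i = true := by simpa [h5] using h4
      rw [(cmp_eq_gt_iff _ _).2 (nodeKey_lt_of_diverge b h2 (by omega) h1 h3.symm h6 h5),
        (cmp_eq_gt_iff _ _).2 (nodeKey_lt_of_diverge b' h2 (by omega) h1 h3.symm h6 h5)]
    · have h6 : l'.testBit i = false := by simpa [h5] using h4
      rw [(cmp_eq_lt_iff _ _).2 (nodeKey_lt_of_diverge b h2 h1 (by omega) h3 h5 h6),
        (cmp_eq_lt_iff _ _).2 (nodeKey_lt_of_diverge b' h2 h1 (by omega) h3 h5 h6)]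

/-- The outcome of a comparison of two nodes depends on `b` only if one of them lies in the second
half below the other. -/
theorem cmp_nodeKey {b b' : Finset (ℕ × ℕ)} {k h h' l l' : ℕ} (hk : h < k) (hk' : h' < k)
    (hl : l < 2 ^ k) (hl' : l' < 2 ^ k)
    (H : h' < h → l / 2 ^ (h + 1) = l' / 2 ^ (h + 1) → l'.testBit h = true →
      ((h, l' / 2 ^ (h + 1)) ∈ b ↔ (h, l' / 2 ^ (h + 1)) ∈ b'))
    (H' : h < h' → l' / 2 ^ (h' + 1) = l / 2 ^ (h' + 1) → l.testBit h' = true →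
      ((h', l / 2 ^ (h' + 1)) ∈ b ↔ (h', l / 2 ^ (h' + 1)) ∈ b')) :
    cmp (nodeKey k b h l) (nodeKey k b h' l') = cmp (nodeKey k b' h l) (nodeKey k b' h' l') := by
  rcases le_total h' h with hh | hh
  · exact cmp_nodeKey_of_le hk hh hl hl' H
  · rw [← cmp_swap (nodeKey k b h' l'), ← cmp_swap (nodeKey k b' h' l'),
      cmp_nodeKey_of_le hk' hh hl' hl H']

/-- Among the nodes that have started by the leaf `l`, exactly those ancestors of `l` lie below it
that have `l` in their first half, or in a second half placed above them. -/
theorem nodeKey_lt_leaf_iff {b : Finset (ℕ × ℕ)} {k h l a : ℕ} (hk : h < k) (hl : l < 2 ^ k)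
    (hal : a ≤ l) :
    nodeKey k b h a < nodeKey k b 0 l ↔ 1 ≤ h ∧ a / 2 ^ (h + 1) = l / 2 ^ (h + 1) ∧
      (l.testBit h = false ∨ (h, l / 2 ^ (h + 1)) ∈ b) := by
  rcases exists_diverge (hal.trans_lt hl) hl h with h1 | ⟨i, h1, h2, h3, h4⟩
  · rcases Nat.eq_zero_or_pos h with rfl | hpos
    · simp [nodeKey_congr k b h1]
    · constructor
      · intro h2
        refine ⟨hpos, h1, ?_⟩
        by_contra h3
        rw [not_or, Bool.not_eq_false] at h3
        exact absurd h2 (descendant_lt_nodeKey b hk hpos h1 h3.1 h3.2).asymm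
      · rintro ⟨-, -, h2⟩
        exact nodeKey_lt_descendant b hk hpos h1 h2
  · have h5 : a.testBit i = false ∧ l.testBit i = true := by
      rw [Nat.testBit_eq_decide_div_mod_eq, Nat.testBit_eq_decide_div_mod_eq] at h4 ⊢
      rw [pow_succ, ← Nat.div_div_eq_div_mul, ← Nat.div_div_eq_div_mul] at h3
      have h6 : a / 2 ^ i ≤ l / 2 ^ i := Nat.div_le_div_right hal
      rw [Ne, decide_eq_decide] at h4
      simp only [decide_eq_false_iff_not, decide_eq_true_eq]
      omega
    constructor
    · intro h6
      exact absurd h6 (nodeKey_lt_of_diverge b h2 (by omega) h1 h3.symm h5.2 h5.1).asymm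
    · rintro ⟨-, h6, -⟩
      rw [testBit_congr h1 h6, h5.2] at h5
      exact absurd h5.1 (by simp)

theorem nodeKey_injOn (k : ℕ) (b : Finset (ℕ × ℕ)) (l : ℕ) :
    Set.InjOn (fun h => nodeKey k b h l) (Set.Iio k) := by
  have key : ∀ h h', h < k → h' < h → nodeKey k b h l ≠ nodeKey k b h' l := by
    intro h h' hk hh
    by_cases h1 : l.testBit h = false ∨ (h, l / 2 ^ (h + 1)) ∈ b
    · exact (nodeKey_lt_descendant b hk hh rfl h1).ne
    · rw [not_or, Bool.not_eq_false] at h1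
      exact (descendant_lt_nodeKey b hk hh rfl h1.1 h1.2).ne'
  intro h hh h' hh' heq
  rcases lt_trichotomy h h' with h1 | h1 | h1
  · exact absurd heq.symm (key _ _ hh' h1)
  · exact h1
  · exact absurd heq (key _ _ hh h1)

namespace ComparisonAlgorithm

variable {n : ℕ} {Info : Type*} {U : Type*} [LinearOrder U]

theorem state_succ (A : ComparisonAlgorithm n Info) (x : Fin n → U) {t : ℕ} (h : t < n) :
    A.state x (t + 1) =
      ((A.step (A.state x t).1 ⟨t, h⟩ (A.state x t).2
          (comparisons x (insert ⟨t, h⟩ (A.state x t).2))).1,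
        (A.step (A.state x t).1 ⟨t, h⟩ (A.state x t).2
          (comparisons x (insert ⟨t, h⟩ (A.state x t).2))).2 ∩
            insert ⟨t, h⟩ (A.state x t).2) := by
  rw [state, dif_pos h]

theorem state_succ_of_le (A : ComparisonAlgorithm n Info) (x : Fin n → U) {t : ℕ} (h : n ≤ t) :
    A.state x (t + 1) = A.state x t := by
  rw [state, dif_neg (by omega)]

theorem memory_succ_subset (A : ComparisonAlgorithm n Info) (x : Fin n → U) {t : ℕ} {p : Fin n}
    (hp : p ∈ A.memory x (t + 1)) : p.1 = t ∨ p ∈ A.memory x t := by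
  unfold memory at hp ⊢
  by_cases h : t < n
  · rw [state_succ A x h, Finset.mem_inter, Finset.mem_insert] at hp
    rcases hp.2 with h1 | h1
    · left; rw [h1]
    · exact Or.inr h1
  · rw [state_succ_of_le A x (by omega)] at hp
    exact Or.inr hp

theorem lt_of_mem_memory (A : ComparisonAlgorithm n Info) (x : Fin n → U) {t : ℕ} {p : Fin n}
    (hp : p ∈ A.memory x t) : p.1 < t := by
  induction t with
  | zero => simp [memory, state] at hp
  | succ t ih =>
    rcases memory_succ_subset A x hp with h | h
    · omega
    · have := ih h; omega

/-- A stored element has been stored ever since it arrived. -/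
theorem mem_memory_of_le (A : ComparisonAlgorithm n Info) (x : Fin n → U) {s t : ℕ} (hst : s ≤ t)
    {p : Fin n} (hp : p ∈ A.memory x t) (hps : p.1 < s) : p ∈ A.memory x s := by
  induction hst with
  | refl => exact hp
  | @step t hst ih =>
    have hst' : s ≤ t := hst
    exact ih ((memory_succ_subset A x hp).resolve_left (by omega))

/-- Two streams lead to the same state if the algorithm never sees a difference between them. -/
theorem state_congr (A : ComparisonAlgorithm n Info) {V : Type*} [LinearOrder V] {x : Fin n → U}
    {x' : Fin n → V} {t : ℕ}
    (H : ∀ s, (hs : s < n) → s < t → ∀ p ∈ insert ⟨s, hs⟩ (A.memory x s),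
      ∀ q ∈ insert ⟨s, hs⟩ (A.memory x s), cmp (x p) (x q) = cmp (x' p) (x' q)) :
    A.state x t = A.state x' t := by
  induction t with
  | zero => rfl
  | succ t ih =>
    have h1 := ih fun s hs hst => H s hs (by omega)
    by_cases h : t < n
    · have h2 : comparisons x (insert ⟨t, h⟩ (A.state x t).2) =
          comparisons x' (insert ⟨t, h⟩ (A.state x t).2) := by
        funext i j
        unfold comparisons
        split_ifs with h3
        · rw [H t h (by omega) i h3.1 j h3.2]
        · rfl
      rw [state_succ A x h, state_succ A x' h, ← h1, h2]
    · rw [state_succ_of_le A x (by omega), state_succ_of_le A x' (by omega), h1]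

theorem answer_congr (A : ComparisonAlgorithm n Info) {V : Type*} [LinearOrder V] {x : Fin n → U}
    {x' : Fin n → V} {y : U} {y' : V} (hs : A.state x n = A.state x' n)
    (H : ∀ p ∈ A.memory x n, ∀ q ∈ A.memory x n, cmp (x p) (x q) = cmp (x' p) (x' q))
    (H' : ∀ p ∈ A.memory x n, cmp (x p) y = cmp (x' p) y') :
    A.answer x y = A.answer x' y' := by
  have hm : A.memory x' n = A.memory x n := by rw [memory, memory, hs]
  have h1 : comparisons x (A.memory x n) = comparisons x' (A.memory x n) := by
    funext i j
    unfold comparisons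
    split_ifs with h3
    · rw [H i h3.1 j h3.2]
    · rfl
  have h2 : queryComparisons x (A.memory x n) y = queryComparisons x' (A.memory x n) y' := by
    funext i
    unfold queryComparisons
    split_ifs with h3
    · rw [H' i h3]
    · rfl
  rw [answer, answer, hm, ← hs, h1, h2]

theorem state_strictMonoOn_comp {V : Type*} [LinearOrder V] {f : V → U} {s : Set V}
    (hf : StrictMonoOn f s) (A : ComparisonAlgorithm n Info) {x : Fin n → V} (hx : ∀ p, x p ∈ s)
    (t : ℕ) : A.state (f ∘ x) t = A.state x t :=
  (state_congr A fun _ _ _ p _ q _ => (hf.cmp_map_eq (hx p) (hx q)).symm).symm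

theorem space_strictMonoOn_comp {V : Type*} [LinearOrder V] {f : V → U} {s : Set V}
    (hf : StrictMonoOn f s) (A : ComparisonAlgorithm n Info) {x : Fin n → V} (hx : ∀ p, x p ∈ s)
    (t : ℕ) : A.space (f ∘ x) t = A.space x t := by
  unfold space memory
  rw [state_strictMonoOn_comp hf A hx, ← Finset.image_image]
  refine Finset.card_image_of_injOn (hf.injOn.mono ?_)
  intro v hv
  obtain ⟨p, -, rfl⟩ := Finset.mem_image.1 hv
  exact hx p

theorem answer_strictMonoOn_comp {V : Type*} [LinearOrder V] {f : V → U} {s : Set V}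
    (hf : StrictMonoOn f s) (A : ComparisonAlgorithm n Info) {x : Fin n → V} (hx : ∀ p, x p ∈ s)
    {y : V} (hy : y ∈ s) : A.answer (f ∘ x) (f y) = A.answer x y :=
  answer_congr A (state_strictMonoOn_comp hf A hx n)
    (fun p _ q _ => hf.cmp_map_eq (hx p) (hx q)) fun p _ => hf.cmp_map_eq (hx p) hy

end ComparisonAlgorithm

theorem streamRank_strictMonoOn_comp {n : ℕ} {U V : Type*} [LinearOrder U] [LinearOrder V]
    {f : V → U} {s : Set V} (hf : StrictMonoOn f s) {x : Fin n → V} (hx : ∀ p, x p ∈ s) {y : V}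
    (hy : y ∈ s) : streamRank (f ∘ x) (f y) = streamRank x y := by
  unfold streamRank
  congr 1
  ext p
  simp [hf.lt_iff_lt (hx p) hy]

/-- The values of the hard stream with parameters `b` and `l`.  Each node arrives `w` times, at the
first leaf below it; at the leaf `l` the construction stops.  All other positions are filled with
the maximal value `4 ^ k`. -/
def treeStream (n k w : ℕ) (b : Finset (ℕ × ℕ)) (l : ℕ) (p : Fin n) : ℕ :=
  if p / w / k ≤ l ∧ 2 ^ (p / w % k + 1) ∣ p / w / k then
    nodeKey k b (p / w % k) (p / w / k) else 4 ^ k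

theorem treeStream_le {n : ℕ} (k w : ℕ) (b : Finset (ℕ × ℕ)) (l : ℕ) (p : Fin n) :
    treeStream n k w b l p ≤ 4 ^ k := by
  unfold treeStream
  split_ifs
  · exact (nodeKey_lt _ _ _ _).le
  · exact le_rfl

theorem card_filter_div_eq {n w q : ℕ} (hw : 0 < w) (h : (q + 1) * w ≤ n) :
    (Finset.univ.filter fun p : Fin n => p / w = q).card = w := by
  have h1 : (Finset.univ.filter fun p : Fin n => p / w = q).map Fin.valEmbedding =
      Finset.Ico (q * w) ((q + 1) * w) := by
    ext p
    simp only [Finset.mem_map, Finset.mem_filter, Finset.mem_univ, true_and,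
      Fin.valEmbedding_apply, Finset.mem_Ico]
    constructor
    · rintro ⟨p, rfl, rfl⟩
      exact ⟨Nat.div_mul_le_self _ _, Nat.lt_mul_of_div_lt (Nat.lt_succ_self _) hw⟩
    · rintro ⟨h1, h2⟩
      exact ⟨⟨p, h2.trans_le h⟩, Nat.div_eq_of_lt_le h1 h2, rfl⟩
  rw [← Finset.card_map Fin.valEmbedding, h1, Nat.card_Ico, add_mul]
  omega

/-- The rank of the leaf where the construction stops. -/
theorem streamRank_treeStream {n k w l : ℕ} {b : Finset (ℕ × ℕ)} (hw : 0 < w)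
    (hn : w * k * 2 ^ k ≤ n) (hl : l < 2 ^ k) :
    streamRank (treeStream n k w b l) (nodeKey k b 0 l) =
      w * ((Finset.Ico 1 k).filter fun h =>
        l.testBit h = false ∨ (h, l / 2 ^ (h + 1)) ∈ b).card := by
  set J := (Finset.Ico 1 k).filter fun h => l.testBit h = false ∨ (h, l / 2 ^ (h + 1)) ∈ b with hJ
  have hslot : ∀ h < k, (l / 2 ^ (h + 1) * 2 ^ (h + 1) * k + h) / k = l / 2 ^ (h + 1) * 2 ^ (h + 1) ∧
      (l / 2 ^ (h + 1) * 2 ^ (h + 1) * k + h) % k = h := by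
    intro h hh
    rw [mul_comm _ k]
    refine ⟨?_, by rw [Nat.mul_add_mod, Nat.mod_eq_of_lt hh]⟩
    rw [Nat.mul_add_div (by omega), Nat.div_eq_of_lt hh, add_zero]
  have hle : ∀ h, l / 2 ^ (h + 1) * 2 ^ (h + 1) ≤ l := fun h => Nat.div_mul_le_self _ _
  have h1 : (Finset.univ.filter fun p : Fin n => treeStream n k w b l p < nodeKey k b 0 l) =
      J.biUnion fun h => Finset.univ.filter fun p : Fin n =>
        p / w = l / 2 ^ (h + 1) * 2 ^ (h + 1) * k + h := by
    ext p
    simp only [Finset.mem_filter, Finset.mem_univ, true_and, Finset.mem_biUnion]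
    constructor
    · intro hp
      unfold treeStream at hp
      split_ifs at hp with h2
      · rcases Nat.eq_zero_or_pos k with rfl | hk
        · simp [nodeKey] at hp
        have hhk : p / w % k < k := Nat.mod_lt _ hk
        rw [nodeKey_lt_leaf_iff hhk hl h2.1] at hp
        refine ⟨p / w % k, ?_, ?_⟩
        · rw [hJ, Finset.mem_filter, Finset.mem_Ico]
          exact ⟨⟨hp.1, hhk⟩, hp.2.2⟩
        · rw [← hp.2.1, Nat.div_mul_cancel h2.2, Nat.div_add_mod']
      · exact absurd hp (nodeKey_lt k b 0 l).le.not_gt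
    · rintro ⟨h, hh, hp⟩
      rw [hJ, Finset.mem_filter, Finset.mem_Ico] at hh
      obtain ⟨h3, h4⟩ := hslot h hh.1.2
      unfold treeStream
      rw [hp, h3, h4, if_pos ⟨hle h, Dvd.intro_left _ rfl⟩, nodeKey_lt_leaf_iff hh.1.2 hl (hle h)]
      exact ⟨hh.1.1, by rw [Nat.mul_div_cancel _ (by positivity)], hh.2⟩
  unfold streamRank
  rw [h1, Finset.card_biUnion, Finset.sum_congr rfl, Finset.sum_const, smul_eq_mul, mul_comm]
  · intro h hh
    rw [hJ, Finset.mem_filter, Finset.mem_Ico] at hh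
    refine card_filter_div_eq hw (le_trans ?_ hn)
    have h2 : l / 2 ^ (h + 1) * 2 ^ (h + 1) * k + h + 1 ≤ 2 ^ k * k := by
      have := Nat.mul_le_mul_right k ((hle h).trans_lt hl : _ + 1 ≤ 2 ^ k)
      rw [Nat.succ_mul] at this
      omega
    calc _ ≤ 2 ^ k * k * w := Nat.mul_le_mul_right w h2
      _ = _ := by ring
  · intro h hh h' hh' hne
    rw [Finset.mem_coe, hJ, Finset.mem_filter, Finset.mem_Ico] at hh hh'
    rw [Function.onFun, Finset.disjoint_left]
    intro p hp hp'
    rw [Finset.mem_filter] at hp hp'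
    have h2 := (hslot h hh.1.2).2
    rw [← hp.2, hp'.2, (hslot h' hh'.1.2).2] at h2
    exact hne h2.symm

/-- `p` is a position of the node `v`, and `q` lies at a leaf in the second half below `v`. -/
def Separates (k w : ℕ) (v : ℕ × ℕ) (p q : ℕ) : Prop :=
  v.1 = p / w % k ∧ p / w / k = v.2 * 2 ^ (v.1 + 1) ∧ v.2 * 2 ^ (v.1 + 1) + 2 ^ v.1 ≤ q / w / k

theorem second_half_le {a l h : ℕ} (h1 : l / 2 ^ (h + 1) = a) (h2 : l.testBit h = true) :
    a * 2 ^ (h + 1) + 2 ^ h ≤ l := by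
  rw [Nat.testBit_eq_decide_div_mod_eq, decide_eq_true_eq] at h2
  rw [pow_succ, ← Nat.div_div_eq_div_mul] at h1
  have h3 : l / 2 ^ h = 2 * a + 1 := by omega
  calc a * 2 ^ (h + 1) + 2 ^ h = (l / 2 ^ h) * 2 ^ h := by rw [h3]; ring
    _ ≤ l := Nat.div_mul_le_self _ _

theorem cmp_treeStream {n k w l : ℕ} {b b' : Finset (ℕ × ℕ)} (hk : 0 < k) (hl : l < 2 ^ k)
    {p q : Fin n} (H : ∀ v ∈ symmDiff b b', ¬ Separates k w v p q ∧ ¬ Separates k w v q p) :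
    cmp (treeStream n k w b l p) (treeStream n k w b l q) =
      cmp (treeStream n k w b' l p) (treeStream n k w b' l q) := by
  have main : ∀ p q : Fin n, (∀ v ∈ symmDiff b b', ¬ Separates k w v p q) →
      2 ^ (p / w % k + 1) ∣ p / w / k →
      p / w / k / 2 ^ (p / w % k + 1) = q / w / k / 2 ^ (p / w % k + 1) →
      (q / w / k).testBit (p / w % k) = true →
      ((p / w % k, q / w / k / 2 ^ (p / w % k + 1)) ∈ b ↔
        (p / w % k, q / w / k / 2 ^ (p / w % k + 1)) ∈ b') := by
    intro p q H h1 h2 h3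
    by_contra h4
    refine H _ (?_ : (p / w % k, q / w / k / 2 ^ (p / w % k + 1)) ∈ symmDiff b b')
      ⟨rfl, ?_, second_half_le rfl h3⟩
    · rw [Finset.mem_symmDiff]; tauto
    · rw [← h2, Nat.div_mul_cancel h1]
  unfold treeStream
  by_cases hp : p / w / k ≤ l ∧ 2 ^ (p / w % k + 1) ∣ p / w / k <;>
    by_cases hq : q / w / k ≤ l ∧ 2 ^ (q / w % k + 1) ∣ q / w / k
  · rw [if_pos hp, if_pos hq, if_pos hp, if_pos hq]
    exact cmp_nodeKey (Nat.mod_lt _ hk) (Nat.mod_lt _ hk) (hp.1.trans_lt hl) (hq.1.trans_lt hl)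
      (fun _ => main p q (fun v hv => (H v hv).1) hp.2)
      (fun _ => main q p (fun v hv => (H v hv).2) hq.2)
  · rw [if_pos hp, if_neg hq, if_pos hp, if_neg hq, (cmp_eq_lt_iff _ _).2 (nodeKey_lt _ _ _ _),
      (cmp_eq_lt_iff _ _).2 (nodeKey_lt _ _ _ _)]
  · rw [if_neg hp, if_pos hq, if_neg hp, if_pos hq, (cmp_eq_gt_iff _ _).2 (nodeKey_lt _ _ _ _),
      (cmp_eq_gt_iff _ _).2 (nodeKey_lt _ _ _ _)]
  · rw [if_neg hp, if_neg hq, if_neg hp, if_neg hq]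

theorem cmp_treeStream_leaf {n k w l : ℕ} {b b' : Finset (ℕ × ℕ)} (hk : 0 < k) (hl : l < 2 ^ k)
    {p : Fin n} (H : ∀ v ∈ symmDiff b b', v.1 = p / w % k → p / w / k = v.2 * 2 ^ (v.1 + 1) →
      ¬ v.2 * 2 ^ (v.1 + 1) + 2 ^ v.1 ≤ l) :
    cmp (treeStream n k w b l p) (nodeKey k b 0 l) =
      cmp (treeStream n k w b' l p) (nodeKey k b' 0 l) := by
  unfold treeStream
  by_cases hp : p / w / k ≤ l ∧ 2 ^ (p / w % k + 1) ∣ p / w / k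
  · rw [if_pos hp, if_pos hp]
    refine cmp_nodeKey (Nat.mod_lt _ hk) hk (hp.1.trans_lt hl) hl (fun _ h2 h3 => ?_)
      fun h => absurd h (Nat.not_lt_zero _)
    by_contra h4
    refine H _ (?_ : (p / w % k, l / 2 ^ (p / w % k + 1)) ∈ symmDiff b b') rfl ?_
      (second_half_le rfl h3)
    · rw [Finset.mem_symmDiff]; tauto
    · rw [← h2, Nat.div_mul_cancel hp.2]
  · rw [if_neg hp, if_neg hp, (cmp_eq_gt_iff _ _).2 (nodeKey_lt _ _ _ _),
      (cmp_eq_gt_iff _ _).2 (nodeKey_lt _ _ _ _)]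

theorem lt_of_div_div_lt {p a k w : ℕ} (hk : 0 < k) (hw : 0 < w) (h : p / w / k < a) :
    p < a * k * w :=
  (Nat.div_lt_iff_lt_mul hw).1 ((Nat.div_lt_iff_lt_mul hk).1 h)

theorem le_of_le_div_div {p a k w : ℕ} (h : a ≤ p / w / k) : a * k * w ≤ p :=
  Nat.mul_le_of_le_div _ _ _ (Nat.mul_le_of_le_div _ _ _ h)

namespace ComparisonAlgorithm

variable {n : ℕ} {Info : Type*}

/-- Some copy of the node `v` is still stored when the second half below `v` begins. -/
def HeldAtTransition (A : ComparisonAlgorithm n Info) (x : Fin n → ℕ) (k w : ℕ) (v : ℕ × ℕ) :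
    Prop :=
  ∃ p ∈ A.memory x ((v.2 * 2 ^ (v.1 + 1) + 2 ^ v.1) * k * w),
    p / w / k = v.2 * 2 ^ (v.1 + 1) ∧ p / w % k = v.1

/-- Flipping `b` at nodes that are discarded in time does not change what the algorithm does. -/
theorem state_treeStream_congr (A : ComparisonAlgorithm n Info) {k w l : ℕ}
    {b b' : Finset (ℕ × ℕ)} (hw : 0 < w) (hk : 0 < k) (hl : l < 2 ^ k)
    (H : ∀ v ∈ symmDiff b b', ¬ A.HeldAtTransition (treeStream n k w b l) k w v) (t : ℕ) :
    A.state (treeStream n k w b l) t = A.state (treeStream n k w b' l) t := by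
  refine state_congr A fun s hs _ p hp q hq => cmp_treeStream hk hl fun v hv => ?_
  have main : ∀ p ∈ insert ⟨s, hs⟩ (A.memory (treeStream n k w b l) s),
      ∀ q ∈ insert ⟨s, hs⟩ (A.memory (treeStream n k w b l) s), ¬ Separates k w v p q := by
    rintro p hp q hq ⟨h1, h2, h3⟩
    have hqs : q.1 ≤ s := by
      rcases Finset.mem_insert.1 hq with rfl | hq
      · exact le_rfl
      · exact (lt_of_mem_memory A _ hq).le
    have h4 := le_of_le_div_div h3
    have h5 : p.1 < (v.2 * 2 ^ (v.1 + 1) + 2 ^ v.1) * k * w :=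
      lt_of_div_div_lt hk hw (by rw [h2]; exact Nat.lt_add_of_pos_right (by positivity))
    have hp' : p ∈ A.memory (treeStream n k w b l) s := by
      refine (Finset.mem_insert.1 hp).resolve_left ?_
      rintro rfl
      simp only at h5 hqs
      omega
    exact H v hv ⟨p, mem_memory_of_le A _ (h4.trans hqs) hp' h5, h2, h1.symm⟩
  exact ⟨main p hp q hq, main q hq p hp⟩

theorem answer_treeStream_congr (A : ComparisonAlgorithm n Info) {k w l : ℕ}
    {b b' : Finset (ℕ × ℕ)} (hw : 0 < w) (hk : 0 < k) (hl : l < 2 ^ k)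
    (hn : w * k * 2 ^ k ≤ n)
    (H : ∀ v ∈ symmDiff b b', ¬ A.HeldAtTransition (treeStream n k w b l) k w v) :
    A.answer (treeStream n k w b l) (nodeKey k b 0 l) =
      A.answer (treeStream n k w b' l) (nodeKey k b' 0 l) := by
  have main : ∀ p ∈ A.memory (treeStream n k w b l) n, ∀ v ∈ symmDiff b b',
      ∀ a ≤ n, v.1 = p / w % k → p / w / k = v.2 * 2 ^ (v.1 + 1) →
      ¬ (v.2 * 2 ^ (v.1 + 1) + 2 ^ v.1) * k * w ≤ a := by
    intro p hp v hv a ha h1 h2 h3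
    exact H v hv ⟨p, mem_memory_of_le A _ (h3.trans ha) hp (lt_of_div_div_lt hk hw
      (by rw [h2]; exact Nat.lt_add_of_pos_right (by positivity))), h2, h1.symm⟩
  refine answer_congr A (state_treeStream_congr A hw hk hl H n)
    (fun p hp q hq => cmp_treeStream hk hl fun v hv => ⟨?_, ?_⟩) fun p hp =>
      cmp_treeStream_leaf hk hl fun v hv h1 h2 h3 => ?_
  · rintro ⟨h1, h2, h3⟩
    exact main p hp v hv q q.2.le h1 h2 (le_of_le_div_div h3)
  · rintro ⟨h1, h2, h3⟩
    exact main q hq v hv p p.2.le h1 h2 (le_of_le_div_div h3)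
  · refine main p hp v hv n le_rfl h1 h2 (le_trans ?_ hn)
    calc _ ≤ 2 ^ k * k * w := Nat.mul_le_mul_right w (Nat.mul_le_mul_right k (h3.trans hl.le))
      _ = _ := by ring

/-- Up to the leaf where the construction stops, the stream does not depend on that leaf. -/
theorem state_treeStream_eq (A : ComparisonAlgorithm n Info) {k w l l' t : ℕ}
    (b : Finset (ℕ × ℕ)) (hl : t ≤ (l + 1) * k * w) (hl' : t ≤ (l' + 1) * k * w) :
    A.state (treeStream n k w b l) t = A.state (treeStream n k w b l') t := by
  refine state_congr A fun s hs hst p hp q hq => ?_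
  have main : ∀ p ∈ insert ⟨s, hs⟩ (A.memory (treeStream n k w b l) s),
      treeStream n k w b l p = treeStream n k w b l' p := by
    intro p hp
    have hps : p.1 ≤ s := by
      rcases Finset.mem_insert.1 hp with rfl | hp
      · exact le_rfl
      · exact (lt_of_mem_memory A _ hp).le
    have h : ∀ l, t ≤ (l + 1) * k * w → p / w / k ≤ l := by
      intro l hl
      by_contra! h
      have := le_of_le_div_div (show l + 1 ≤ p / w / k from h)
      omega
    unfold treeStream
    simp only [h l hl, h l' hl', true_and]
  rw [main p hp, main q hq]

theorem heldAtTransition_iff_of_lt (A : ComparisonAlgorithm n Info) {k w l l' : ℕ}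
    (b : Finset (ℕ × ℕ)) {v : ℕ × ℕ} (h : v.2 * 2 ^ (v.1 + 1) + 2 ^ v.1 ≤ l) (hl : l ≤ l') :
    A.HeldAtTransition (treeStream n k w b l) k w v ↔
      A.HeldAtTransition (treeStream n k w b l') k w v := by
  unfold HeldAtTransition memory
  rw [state_treeStream_eq A (l := l) (l' := l') b] <;>
  · rw [mul_assoc, mul_assoc]
    exact Nat.mul_le_mul_right _ (by omega)

open Classical in
/-- The ancestors that have `l` in their first half and are kept until their transition occupy
space at the leaf `l`. -/
theorem card_held_le_space (A : ComparisonAlgorithm n Info) {k w l l' : ℕ} (b : Finset (ℕ × ℕ))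
    (hw : 0 < w) (hk : 0 < k) (hl' : l ≤ l') :
    ((Finset.Ico 1 k).filter fun h => l.testBit h = false ∧
      A.HeldAtTransition (treeStream n k w b l') k w (h, l / 2 ^ (h + 1))).card ≤
      A.space (treeStream n k w b l') ((l + 1) * k * w) := by
  unfold space
  rw [← Finset.card_image_of_injOn ((nodeKey_injOn k b l).mono _)]
  · refine Finset.card_le_card fun y hy => ?_
    obtain ⟨h, hh, rfl⟩ := Finset.mem_image.1 hy
    rw [Finset.mem_filter, Finset.mem_Ico] at hh
    obtain ⟨hhk, hbit, p, hp, h1, h2⟩ := hh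
    dsimp only at hp h1 h2
    have h3 : l / 2 ^ (h + 1) * 2 ^ (h + 1) ≤ l := Nat.div_mul_le_self _ _
    have h4 : l + 1 ≤ l / 2 ^ (h + 1) * 2 ^ (h + 1) + 2 ^ h := by
      rw [Nat.testBit_eq_decide_div_mod_eq, decide_eq_false_iff_not] at hbit
      have h5 : l / 2 ^ (h + 1) * 2 ^ (h + 1) = (l / 2 ^ h) * 2 ^ h := by
        rw [pow_succ, ← Nat.div_div_eq_div_mul]
        have : l / 2 ^ h = l / 2 ^ h / 2 * 2 := by omega
        conv_rhs => rw [this]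
        ring
      rw [h5]
      have := Nat.lt_div_mul_add (a := l) (show 0 < 2 ^ h by positivity)
      omega
    refine Finset.mem_image.2 ⟨p, mem_memory_of_le A _ ?_ hp (lt_of_div_div_lt hk hw (by omega)), ?_⟩
    · exact Nat.mul_le_mul_right _ (Nat.mul_le_mul_right _ h4)
    · unfold treeStream
      rw [h1, h2, if_pos ⟨by omega, Dvd.intro_left _ rfl⟩]
      exact nodeKey_congr k b (by rw [Nat.mul_div_cancel _ (by positivity)])
  · intro h hh
    rw [Finset.coe_filter] at hh
    exact (Finset.mem_Ico.1 hh.1).2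

end ComparisonAlgorithm

theorem mul_centralBinom_sq_le (m : ℕ) : (2 * m + 1) * m.centralBinom ^ 2 ≤ 16 ^ m := by
  induction m with
  | zero => simp
  | succ m ih =>
    have h1 := Nat.succ_mul_centralBinom_succ m
    have h2 : (m + 1) ^ 2 * ((2 * (m + 1) + 1) * (m + 1).centralBinom ^ 2) ≤
        (m + 1) ^ 2 * 16 ^ (m + 1) := by
      calc (m + 1) ^ 2 * ((2 * (m + 1) + 1) * (m + 1).centralBinom ^ 2)
          = (2 * (m + 1) + 1) * ((m + 1) * (m + 1).centralBinom) ^ 2 := by ring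
        _ = (4 * ((2 * m + 3) * (2 * m + 1))) * ((2 * m + 1) * m.centralBinom ^ 2) := by
            rw [h1]; ring
        _ ≤ (16 * (m + 1) ^ 2) * 16 ^ m := Nat.mul_le_mul (by nlinarith) ih
        _ = (m + 1) ^ 2 * 16 ^ (m + 1) := by ring
    exact Nat.le_of_mul_le_mul_left h2 (by positivity)

theorem mul_choose_middle_sq_le (n : ℕ) : n * (n.choose (n / 2)) ^ 2 ≤ 4 ^ n := by
  obtain ⟨m, rfl | rfl⟩ := Nat.even_or_odd' n
  · have h := mul_centralBinom_sq_le m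
    rw [Nat.mul_div_cancel_left m two_pos, pow_mul]
    rw [Nat.centralBinom] at h
    norm_num
    nlinarith [sq_nonneg ((2 * m).choose m)]
  · have h := mul_centralBinom_sq_le (m + 1)
    have h1 : (m + 1).centralBinom = 2 * (2 * m + 1).choose m := by
      rw [Nat.centralBinom, mul_add, mul_one, Nat.choose_succ_succ' (2 * m + 1) m,
        ← Nat.choose_symm_half m]
      ring
    rw [show (2 * m + 1) / 2 = m by omega, pow_succ 4, pow_mul]
    rw [h1, pow_succ 16] at h
    norm_num
    nlinarith [sq_nonneg ((2 * m + 1).choose m)]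

theorem card_le_of_forall_sub_le {T : Finset ℕ} {L : ℝ} (hL : 0 ≤ L)
    (h : ∀ a ∈ T, ∀ b ∈ T, (b : ℝ) - a ≤ L) : (T.card : ℝ) ≤ L + 1 := by
  rcases T.eq_empty_or_nonempty with rfl | hT
  · simp; linarith
  · have h1 : T.card ≤ T.max' hT + 1 - T.min' hT := by
      rw [← Nat.card_Icc]
      exact Finset.card_le_card fun a ha => Finset.mem_Icc.2 ⟨T.min'_le a ha, T.le_max' a ha⟩
    have h2 := h _ (T.min'_mem hT) _ (T.max'_mem hT)
    have h3 : T.min' hT ≤ T.max' hT := T.min'_le _ (T.max'_mem hT)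
    have h4 : T.card + T.min' hT ≤ T.max' hT + 1 := by omega
    have h5 : (T.card : ℝ) + T.min' hT ≤ T.max' hT + 1 := by exact_mod_cast h4
    linarith

open Classical in
/-- Anticoncentration of the cardinality of a random subset. -/
theorem card_powerset_filter_le {α : Type*} (D : Finset α) {w : ℕ} (hw : 0 < w) (c : ℕ) (a : ℝ)
    {s : ℝ} (hs : 0 ≤ s) :
    ((D.powerset.filter fun S => |((w * (c + S.card) : ℕ) : ℝ) - a| ≤ s).card : ℝ) ≤
      (2 * s / w + 1) * D.card.choose (D.card / 2) := by
  have hw' : (0 : ℝ) < w := by exact_mod_cast hw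
  set T := (Finset.range (D.card + 1)).filter fun r => |((w * (c + r) : ℕ) : ℝ) - a| ≤ s with hT
  have h1 : (D.powerset.filter fun S => |((w * (c + S.card) : ℕ) : ℝ) - a| ≤ s) ⊆
      T.biUnion fun r => D.powersetCard r := by
    intro S hS
    rw [Finset.mem_filter, Finset.mem_powerset] at hS
    refine Finset.mem_biUnion.2 ⟨S.card, ?_, Finset.mem_powersetCard.2 ⟨hS.1, rfl⟩⟩
    exact Finset.mem_filter.2
      ⟨Finset.mem_range.2 (Nat.lt_succ_of_le (Finset.card_le_card hS.1)), hS.2⟩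
  have h2 : (D.powerset.filter fun S => |((w * (c + S.card) : ℕ) : ℝ) - a| ≤ s).card ≤
      T.card * D.card.choose (D.card / 2) := by
    refine (Finset.card_le_card h1).trans (Finset.card_biUnion_le_card_mul _ _ _ fun r _ => ?_)
    rw [Finset.card_powersetCard]
    exact Nat.choose_le_middle _ _
  have h3 : (T.card : ℝ) ≤ 2 * s / w + 1 := by
    refine card_le_of_forall_sub_le (by positivity) fun r hr q hq => ?_
    have hr' := abs_le.1 (Finset.mem_filter.1 hr).2
    have hq' := abs_le.1 (Finset.mem_filter.1 hq).2
    push_cast at hr' hq'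
    rw [le_div_iff₀ hw']
    nlinarith
  calc _ ≤ (T.card : ℝ) * D.card.choose (D.card / 2) := by exact_mod_cast h2
    _ ≤ _ := by gcongr

open Classical in
theorem two_pow_card_le {α : Type*} (D : Finset α) {w : ℕ} (hw : 0 < w) (c : ℕ) (a : ℝ)
    {s : ℝ} (hs : 0 ≤ s) (hD : 4 * (2 * s / w + 1) ^ 2 ≤ D.card) :
    2 ^ D.card ≤
      2 * (D.powerset.filter fun S => s < |((w * (c + S.card) : ℕ) : ℝ) - a|).card := by
  have h1 := card_powerset_filter_le D hw c a hs
  have h2 := Finset.card_filter_add_card_filter_not (s := D.powerset)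
    (fun S => |((w * (c + S.card) : ℕ) : ℝ) - a| ≤ s)
  simp only [not_le, Finset.card_powerset] at h2
  have h3 : ((D.card * (D.card.choose (D.card / 2)) ^ 2 : ℕ) : ℝ) ≤ (4 ^ D.card : ℕ) := by
    exact_mod_cast mul_choose_middle_sq_le D.card
  have h4 : 2 * ((2 * s / w + 1) * (D.card.choose (D.card / 2) : ℝ)) ≤ 2 ^ D.card := by
    refine le_of_sq_le_sq ?_ (by positivity)
    have h5 : ((2 : ℝ) ^ D.card) ^ 2 = 4 ^ D.card := by
      rw [← pow_mul, mul_comm, pow_mul]; norm_num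
    rw [h5]
    push_cast at h3
    refine le_trans ?_ h3
    rw [mul_pow, mul_pow, ← mul_assoc]
    gcongr
    linarith
  have h6 : 2 * ((D.powerset.filter fun S => |((w * (c + S.card) : ℕ) : ℝ) - a| ≤ s).card) ≤
      2 ^ D.card := by
    have : (2 : ℝ) * ((D.powerset.filter fun S => |((w * (c + S.card) : ℕ) : ℝ) - a| ≤ s).card)
      ≤ 2 ^ D.card := by linarith
    exact_mod_cast this
  omega

open Classical in
/-- If `b` can be changed freely on `D b`, and at least half of these changes have the property
`F` whenever `D b` is large, then at most twice as many sets have a large `D b` as have `F`. -/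
theorem card_large_le_two_mul_card {α : Type*} [DecidableEq α] (V : Finset α) (D : Finset α → Finset α)
    (F : Finset α → Prop) (m : ℕ) (hD : ∀ b ⊆ V, D b ⊆ V)
    (hinv : ∀ b ⊆ V, ∀ S ⊆ D b, D (symmDiff b S) = D b)
    (hF : ∀ b ⊆ V, m ≤ (D b).card →
      2 ^ (D b).card ≤ 2 * ((D b).powerset.filter fun S => F (symmDiff b S)).card) :
    (V.powerset.filter fun b => m ≤ (D b).card).card ≤ 2 * (V.powerset.filter F).card := by
  set g : Finset α → Finset α → ℚ := fun b S =>
    if m ≤ (D b).card ∧ S ⊆ D b ∧ F b then 2 / 2 ^ (D b).card else 0 with hg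
  have hsd : ∀ b ∈ V.powerset, ∀ S ∈ V.powerset, symmDiff b S ∈ V.powerset := by
    intro b hb S hS
    rw [Finset.mem_powerset] at *
    exact symmDiff_le (hb.trans le_sup_right) (hS.trans le_sup_right)
  have h1 : ∀ b ∈ V.powerset, ((if m ≤ (D b).card then 1 else 0 : ℕ) : ℚ) ≤
      ∑ S ∈ V.powerset, g (symmDiff b S) S := by
    intro b hb
    have hb' := Finset.mem_powerset.1 hb
    split_ifs with hm
    · have h2 : ∑ S ∈ (D b).powerset.filter (fun S => F (symmDiff b S)), g (symmDiff b S) S ≤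
          ∑ S ∈ V.powerset, g (symmDiff b S) S := by
        refine Finset.sum_le_sum_of_subset_of_nonneg
          ((Finset.filter_subset _ _).trans (Finset.powerset_mono.2 (hD b hb'))) fun S _ _ => ?_
        simp only [hg]
        split_ifs <;> positivity
      refine le_trans ?_ h2
      rw [Finset.sum_congr rfl (g := fun _ => (2 / 2 ^ (D b).card : ℚ))]
      · rw [Finset.sum_const, nsmul_eq_mul, mul_div_assoc', le_div_iff₀ (by positivity)]
        have := hF b hb' hm
        rw [Nat.cast_one, one_mul, mul_comm]
        exact_mod_cast this
      · intro S hS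
        rw [Finset.mem_filter, Finset.mem_powerset] at hS
        simp only [hg, hinv b hb' S hS.1]
        rw [if_pos ⟨hm, hS.1, hS.2⟩]
    · rw [Nat.cast_zero]
      refine Finset.sum_nonneg fun S _ => ?_
      simp only [hg]
      split_ifs <;> positivity
  have h2 : ∀ S ∈ V.powerset, ∑ b ∈ V.powerset, g (symmDiff b S) S =
      ∑ b ∈ V.powerset, g b S := by
    intro S hS
    refine Finset.sum_nbij' (fun b => symmDiff b S) (fun b => symmDiff b S)
      (fun b hb => hsd b hb S hS) (fun b hb => hsd b hb S hS) ?_ ?_ fun b _ => rfl <;>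
    · intro b _
      exact symmDiff_symmDiff_cancel_right _ _
  have h3 : ∀ b ∈ V.powerset, ∑ S ∈ V.powerset, g b S ≤
      2 * ((if F b then 1 else 0 : ℕ) : ℚ) := by
    intro b hb
    have hb' := Finset.mem_powerset.1 hb
    by_cases h4 : F b
    · have h5 : ∑ S ∈ V.powerset, g b S ≤
          ∑ S ∈ V.powerset, if S ∈ (D b).powerset then (2 / 2 ^ (D b).card : ℚ) else 0 := by
        refine Finset.sum_le_sum fun S _ => ?_
        simp only [hg, Finset.mem_powerset]
        split_ifs with h6 h7 h7
        · exact le_rfl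
        · exact absurd h6.2.1 h7
        · positivity
        · exact le_rfl
      refine h5.trans ?_
      rw [← Finset.sum_filter, Finset.sum_const, nsmul_eq_mul, Finset.filter_mem_eq_inter,
        Finset.inter_eq_right.2 (Finset.powerset_mono.2 (hD b hb')), Finset.card_powerset,
        if_pos h4]
      push_cast
      rw [mul_div_assoc', mul_comm, mul_div_assoc, div_self (by positivity), mul_one]
    · refine (Finset.sum_eq_zero fun S _ => ?_).le.trans (by positivity)
      simp only [hg]
      rw [if_neg (by tauto)]
  have h4 : ((V.powerset.filter fun b => m ≤ (D b).card).card : ℚ) ≤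
      2 * ((V.powerset.filter F).card : ℚ) := by
    rw [Finset.card_filter, Finset.card_filter, Nat.cast_sum, Nat.cast_sum, Finset.mul_sum]
    calc _ ≤ ∑ b ∈ V.powerset, ∑ S ∈ V.powerset, g (symmDiff b S) S := Finset.sum_le_sum h1
      _ = ∑ b ∈ V.powerset, ∑ S ∈ V.powerset, g b S := by
          rw [Finset.sum_comm, Finset.sum_congr rfl h2, Finset.sum_comm]
      _ ≤ _ := Finset.sum_le_sum h3
  exact_mod_cast h4

open Classical in
theorem card_second_half_eq_card_first_half {k h : ℕ} (hk : h < k) (Q : ℕ → Prop) :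
    ((Finset.range (2 ^ k)).filter fun l => l.testBit h = true ∧ Q (l / 2 ^ (h + 1))).card =
      ((Finset.range (2 ^ k)).filter fun l => l.testBit h = false ∧ Q (l / 2 ^ (h + 1))).card := by
  have hlt : ∀ l < 2 ^ k, l ^^^ 2 ^ h < 2 ^ k := fun l hl =>
    Nat.xor_lt_two_pow hl (Nat.pow_lt_pow_right (by omega) hk)
  have hdiv : ∀ l, (l ^^^ 2 ^ h) / 2 ^ (h + 1) = l / 2 ^ (h + 1) := by
    intro l
    rw [Nat.xor_div_two_pow, Nat.div_eq_of_lt (Nat.pow_lt_pow_right (by omega) (by omega) :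
      2 ^ h < 2 ^ (h + 1)), Nat.xor_zero]
  refine Finset.card_nbij' (fun l => l ^^^ 2 ^ h) (fun l => l ^^^ 2 ^ h) ?_ ?_ ?_ ?_
  · intro l hl
    simp only [Finset.coe_filter, Finset.mem_range, Set.mem_ofPred_eq, hdiv, Nat.testBit_xor,
      Nat.testBit_two_pow_self] at hl ⊢
    exact ⟨hlt l hl.1, by simp [hl.2.1], hl.2.2⟩
  · intro l hl
    simp only [Finset.coe_filter, Finset.mem_range, Set.mem_ofPred_eq, hdiv, Nat.testBit_xor,
      Nat.testBit_two_pow_self] at hl ⊢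
    exact ⟨hlt l hl.1, by simp [hl.2.1], hl.2.2⟩
  · intro l _; simp
  · intro l _; simp

open Classical in
theorem sum_card_second_half_eq (k : ℕ) (Q : ℕ × ℕ → Prop) :
    ∑ l ∈ Finset.range (2 ^ k), ((Finset.Ico 1 k).filter fun h =>
        l.testBit h = true ∧ Q (h, l / 2 ^ (h + 1))).card =
      ∑ l ∈ Finset.range (2 ^ k), ((Finset.Ico 1 k).filter fun h =>
        l.testBit h = false ∧ Q (h, l / 2 ^ (h + 1))).card := by
  refine (Finset.sum_card_bipartiteAbove_eq_sum_card_bipartiteBelow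
    (fun l h : ℕ => l.testBit h = true ∧ Q (h, l / 2 ^ (h + 1)))).trans (Eq.trans ?_
      (Finset.sum_card_bipartiteAbove_eq_sum_card_bipartiteBelow
        (fun l h : ℕ => l.testBit h = false ∧ Q (h, l / 2 ^ (h + 1)))).symm)
  exact Finset.sum_congr rfl fun h hh =>
    card_second_half_eq_card_first_half (Finset.mem_Ico.1 hh).2 fun a => Q (h, a)

theorem two_mul_sum_card_second_half (k : ℕ) :
    2 * ∑ l ∈ Finset.range (2 ^ k), ((Finset.Ico 1 k).filter fun h => l.testBit h = true).card =
      (k - 1) * 2 ^ k := by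
  have h := sum_card_second_half_eq k fun _ => True
  simp only [and_true] at h
  rw [two_mul]
  nth_rewrite 2 [h]
  rw [← Finset.sum_add_distrib, Finset.sum_congr rfl (g := fun _ => k - 1)]
  · rw [Finset.sum_const, Finset.card_range, smul_eq_mul, mul_comm]
  · intro l _
    have := Finset.card_filter_add_card_filter_not (s := Finset.Ico 1 k)
      (fun h => l.testBit h = true)
    simpa using this

namespace ComparisonAlgorithm

variable {n : ℕ} {Info : Type*}

open Classical in
/-- The nodes above `l` whose bit in `b` the algorithm cannot know: they have `l` in their second
half and are discarded before their transition. -/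
noncomputable def hiddenNodes (A : ComparisonAlgorithm n Info) (k w l : ℕ) (b : Finset (ℕ × ℕ)) :
    Finset (ℕ × ℕ) :=
  ((Finset.Ico 1 k).filter fun h => l.testBit h = true ∧
    ¬ A.HeldAtTransition (treeStream n k w b l) k w (h, l / 2 ^ (h + 1))).image
      fun h => (h, l / 2 ^ (h + 1))

theorem mem_hiddenNodes {A : ComparisonAlgorithm n Info} {k w l : ℕ} {b : Finset (ℕ × ℕ)}
    {v : ℕ × ℕ} : v ∈ A.hiddenNodes k w l b ↔ (1 ≤ v.1 ∧ v.1 < k) ∧ l.testBit v.1 = true ∧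
      v.2 = l / 2 ^ (v.1 + 1) ∧ ¬ A.HeldAtTransition (treeStream n k w b l) k w v := by
  obtain ⟨h, a⟩ := v
  simp only [hiddenNodes, Finset.mem_image, Finset.mem_filter, Finset.mem_Ico, Prod.mk.injEq]
  constructor
  · rintro ⟨h, h1, rfl, rfl⟩
    exact ⟨h1.1, h1.2.1, rfl, h1.2.2⟩
  · rintro ⟨h1, h2, rfl, h3⟩
    exact ⟨h, ⟨h1, h2, h3⟩, rfl, rfl⟩

open Classical in
theorem card_hiddenNodes (A : ComparisonAlgorithm n Info) (k w l : ℕ) (b : Finset (ℕ × ℕ)) :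
    (A.hiddenNodes k w l b).card = ((Finset.Ico 1 k).filter fun h => l.testBit h = true ∧
      ¬ A.HeldAtTransition (treeStream n k w b l) k w (h, l / 2 ^ (h + 1))).card :=
  Finset.card_image_of_injective _ fun _ _ h => (Prod.mk.inj h).1

theorem card_hiddenNodes_le (A : ComparisonAlgorithm n Info) (k w l : ℕ) (b : Finset (ℕ × ℕ)) :
    (A.hiddenNodes k w l b).card ≤ k := by
  classical
  rw [card_hiddenNodes]
  refine (Finset.card_filter_le _ _).trans ?_
  rw [Nat.card_Ico]
  omega

theorem hiddenNodes_symmDiff (A : ComparisonAlgorithm n Info) {k w l : ℕ} (hw : 0 < w)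
    (hk : 0 < k) (hl : l < 2 ^ k) {b S : Finset (ℕ × ℕ)} (hS : S ⊆ A.hiddenNodes k w l b) :
    A.hiddenNodes k w l (symmDiff b S) = A.hiddenNodes k w l b := by
  have h := state_treeStream_congr A (b := b) (b' := symmDiff b S) hw hk hl (fun v hv => by
    rw [symmDiff_symmDiff_cancel_left] at hv
    exact (mem_hiddenNodes.1 (hS hv)).2.2.2)
  ext v
  rw [mem_hiddenNodes, mem_hiddenNodes]
  unfold HeldAtTransition memory
  rw [h]

/-- The answer to the query at the leaf `l` is off by more than `s`. -/
def Fails (A : ComparisonAlgorithm n Info) (k w : ℕ) (s : ℝ) (l : ℕ) (b : Finset (ℕ × ℕ)) : Prop :=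
  s < |(streamRank (treeStream n k w b l) (nodeKey k b 0 l) : ℝ) -
    A.answer (treeStream n k w b l) (nodeKey k b 0 l)|

theorem exists_streamRank_symmDiff (A : ComparisonAlgorithm n Info) {k w l : ℕ} (hw : 0 < w)
    (hn : w * k * 2 ^ k ≤ n) (hl : l < 2 ^ k) (b : Finset (ℕ × ℕ)) :
    ∃ c, ∀ S ⊆ A.hiddenNodes k w l b,
      streamRank (treeStream n k w (symmDiff b S) l) (nodeKey k (symmDiff b S) 0 l) =
        w * (c + (symmDiff (b ∩ A.hiddenNodes k w l b) S).card) := by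
  classical
  set D := A.hiddenNodes k w l b with hD
  refine ⟨((Finset.Ico 1 k).filter fun h => (l.testBit h = false ∨ (h, l / 2 ^ (h + 1)) ∈ b) ∧
    (h, l / 2 ^ (h + 1)) ∉ D).card, fun S hS => ?_⟩
  rw [streamRank_treeStream hw hn hl]
  congr 1
  rw [← Finset.card_filter_add_card_filter_not (fun h => (h, l / 2 ^ (h + 1)) ∉ D),
    Finset.filter_filter, Finset.filter_filter]
  congr 1
  · congr 1
    refine Finset.filter_congr fun h _ => and_congr_left fun h1 => or_congr_right ?_
    have : (h, l / 2 ^ (h + 1)) ∉ S := fun h2 => h1 (hS h2)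
    rw [Finset.mem_symmDiff]
    tauto
  · refine Finset.card_bij (fun h _ => (h, l / 2 ^ (h + 1))) ?_ ?_ ?_
    · intro h hh
      rw [Finset.mem_filter, not_not] at hh
      have h1 := (mem_hiddenNodes.1 hh.2.2).2.1
      have h2 := hh.2.1.resolve_left (by simp [h1])
      have h3 := hh.2.2
      rw [Finset.mem_symmDiff] at h2 ⊢
      rw [Finset.mem_inter]
      tauto
    · intro h _ h' _ heq
      exact (Prod.mk.inj heq).1
    · intro v hv
      have h1 : v ∈ D ∧ v ∈ symmDiff b S := by
        have := @hS v
        rw [Finset.mem_symmDiff, Finset.mem_inter] at hv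
        rw [Finset.mem_symmDiff]
        tauto
      obtain ⟨h2, h3⟩ := h1
      have h4 := mem_hiddenNodes.1 h2
      have h5 : (v.1, l / 2 ^ (v.1 + 1)) = v := by rw [← h4.2.2.1]
      refine ⟨v.1, ?_, h5⟩
      rw [Finset.mem_filter, Finset.mem_Ico, h5]
      exact ⟨h4.1, Or.inr h3, not_not.2 h2⟩

open Classical in
theorem two_pow_card_hiddenNodes_le (A : ComparisonAlgorithm n Info) {k w l : ℕ} (hw : 0 < w)
    (hk : 0 < k) (hn : w * k * 2 ^ k ≤ n) (hl : l < 2 ^ k) {s : ℝ} (hs : 0 ≤ s)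
    (b : Finset (ℕ × ℕ)) (hm : 4 * (2 * s / w + 1) ^ 2 ≤ (A.hiddenNodes k w l b).card) :
    2 ^ (A.hiddenNodes k w l b).card ≤ 2 * ((A.hiddenNodes k w l b).powerset.filter fun S =>
      A.Fails k w s l (symmDiff b S)).card := by
  obtain ⟨c, hc⟩ := exists_streamRank_symmDiff A hw hn hl b
  set D := A.hiddenNodes k w l b with hD
  refine (two_pow_card_le D hw c (A.answer (treeStream n k w b l) (nodeKey k b 0 l)) hs hm).trans ?_
  refine Nat.mul_le_mul_left 2 (Finset.card_le_card_of_injOn (fun S => symmDiff (b ∩ D) S) ?_ ?_)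
  · intro S hS
    rw [Finset.mem_coe, Finset.mem_filter, Finset.mem_powerset] at hS
    have h1 : symmDiff (b ∩ D) S ⊆ D := by
      intro v hv
      have := @hS.1 v
      rw [Finset.mem_symmDiff, Finset.mem_inter] at hv
      tauto
    rw [Finset.mem_coe, Finset.mem_filter, Finset.mem_powerset]
    refine ⟨h1, ?_⟩
    have h2 := answer_treeStream_congr A (b := b) (b' := symmDiff b (symmDiff (b ∩ D) S))
      hw hk hl hn (fun v hv => by
        rw [symmDiff_symmDiff_cancel_left] at hv
        exact (mem_hiddenNodes.1 (h1 hv)).2.2.2)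
    unfold Fails
    rw [← h2, hc _ h1, symmDiff_symmDiff_cancel_left]
    exact hS.2
  · intro S _ S' _ h
    exact symmDiff_right_injective _ h

open Classical in
theorem sum_card_hiddenNodes_le (A : ComparisonAlgorithm n Info) {k w l m : ℕ} (hw : 0 < w)
    (hk : 0 < k) (hn : w * k * 2 ^ k ≤ n) (hl : l < 2 ^ k) {s : ℝ} (hs : 0 ≤ s)
    (hm : 4 * (2 * s / w + 1) ^ 2 ≤ m) :
    ∑ b ∈ (Finset.range k ×ˢ Finset.range (2 ^ k)).powerset, (A.hiddenNodes k w l b).card ≤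
      (Finset.range k ×ˢ Finset.range (2 ^ k)).powerset.card * m +
        2 * k * ((Finset.range k ×ˢ Finset.range (2 ^ k)).powerset.filter
          (A.Fails k w s l)).card := by
  set V := Finset.range k ×ˢ Finset.range (2 ^ k) with hV
  have h1 := card_large_le_two_mul_card V (A.hiddenNodes k w l) (A.Fails k w s l) m
    (fun b _ v hv => by
      have h1 := mem_hiddenNodes.1 hv
      rw [hV, Finset.mem_product, Finset.mem_range, Finset.mem_range, h1.2.2.1]
      exact ⟨h1.1.2, (Nat.div_le_self _ _).trans_lt hl⟩)
    (fun b _ S hS => hiddenNodes_symmDiff A hw hk hl hS)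
    (fun b _ hb => two_pow_card_hiddenNodes_le A hw hk hn hl hs b
      (hm.trans (by exact_mod_cast hb)))
  have h2 : ∀ b ∈ V.powerset, (A.hiddenNodes k w l b).card ≤
      m + k * (if m ≤ (A.hiddenNodes k w l b).card then 1 else 0) := by
    intro b _
    have := card_hiddenNodes_le A k w l b
    split_ifs with h3
    · rw [mul_one]; exact this.trans (Nat.le_add_left _ _)
    · exact (not_le.1 h3).le.trans (Nat.le_add_right _ _)
  refine (Finset.sum_le_sum h2).trans ?_
  rw [Finset.sum_add_distrib, Finset.sum_const, smul_eq_mul, ← Finset.mul_sum,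
    ← Finset.card_filter]
  have h3 := Nat.mul_le_mul_left k h1
  calc _ ≤ V.powerset.card * m + k * (2 * (V.powerset.filter (A.Fails k w s l)).card) :=
        Nat.add_le_add_left h3 _
    _ = _ := by ring

theorem sum_second_half_le (A : ComparisonAlgorithm n Info) {k w : ℕ} (hw : 0 < w)
    (hk : 0 < k) (b : Finset (ℕ × ℕ)) :
    (k - 1) * 2 ^ k ≤ 2 * ∑ l ∈ Finset.range (2 ^ k), (A.hiddenNodes k w l b).card +
      2 * ∑ l ∈ Finset.range (2 ^ k),
        A.space (treeStream n k w b (2 ^ k)) ((l + 1) * k * w) := by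
  classical
  rw [← two_mul_sum_card_second_half, ← mul_add]
  refine Nat.mul_le_mul_left 2 ?_
  have h1 : ∑ l ∈ Finset.range (2 ^ k), ((Finset.Ico 1 k).filter fun h => l.testBit h = true ∧
        A.HeldAtTransition (treeStream n k w b (2 ^ k)) k w (h, l / 2 ^ (h + 1))).card ≤
      ∑ l ∈ Finset.range (2 ^ k), A.space (treeStream n k w b (2 ^ k)) ((l + 1) * k * w) := by
    rw [sum_card_second_half_eq k fun v => A.HeldAtTransition (treeStream n k w b (2 ^ k)) k w v]
    exact Finset.sum_le_sum fun l hl =>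
      card_held_le_space A b hw hk (Finset.mem_range.1 hl).le
  refine le_trans ?_ (Nat.add_le_add_left h1 _)
  rw [← Finset.sum_add_distrib]
  refine Finset.sum_le_sum fun l hl => ?_
  rw [card_hiddenNodes, ← Finset.card_filter_add_card_filter_not (s := Finset.filter _ _)
    (fun h => ¬ A.HeldAtTransition (treeStream n k w b l) k w (h, l / 2 ^ (h + 1))),
    Finset.filter_filter, Finset.filter_filter]
  refine Nat.add_le_add_left (Finset.card_le_card fun h hh => ?_) _
  rw [Finset.mem_filter, not_not] at hh
  rw [Finset.mem_filter]
  exact ⟨hh.1, hh.2.1, (heldAtTransition_iff_of_lt A b (second_half_le rfl hh.2.1)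
    (Finset.mem_range.1 hl).le).1 hh.2.2⟩

open Classical in
/-- The trade-off between space and failures, summed over all hard streams. -/
theorem space_failure_tradeoff (A : ComparisonAlgorithm n Info) {k w m : ℕ} (hw : 0 < w)
    (hk : 0 < k) (hn : w * k * 2 ^ k ≤ n) {s : ℝ} (hs : 0 ≤ s)
    (hm : 4 * (2 * s / w + 1) ^ 2 ≤ m) {B : Finset (Finset (ℕ × ℕ))}
    (hB : B = (Finset.range k ×ˢ Finset.range (2 ^ k)).powerset) :
    (B.card * 2 ^ k) * (k - 1) ≤
      2 * ∑ b ∈ B, ∑ l ∈ Finset.range (2 ^ k),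
        A.space (treeStream n k w b (2 ^ k)) ((l + 1) * k * w) +
      2 * m * (B.card * 2 ^ k) +
      4 * k * ∑ b ∈ B, ∑ l ∈ Finset.range (2 ^ k), if A.Fails k w s l b then 1 else 0 := by
  have h1 := Finset.sum_le_sum fun b (_ : b ∈ B) => sum_second_half_le (w := w) A hw hk b
  rw [Finset.sum_const, Finset.sum_add_distrib, ← Finset.mul_sum, ← Finset.mul_sum,
    smul_eq_mul] at h1
  have h2 : ∑ b ∈ B, ∑ l ∈ Finset.range (2 ^ k), (A.hiddenNodes k w l b).card ≤
      2 ^ k * (B.card * m) +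
        2 * k * ∑ b ∈ B, ∑ l ∈ Finset.range (2 ^ k), if A.Fails k w s l b then 1 else 0 := by
    rw [Finset.sum_comm, Finset.sum_comm (s := B) (f := fun b l => if A.Fails k w s l b then 1 else 0)]
    refine (Finset.sum_le_sum fun l hl =>
      hB ▸ sum_card_hiddenNodes_le A hw hk hn (Finset.mem_range.1 hl) hs hm).trans ?_
    rw [Finset.sum_add_distrib, Finset.sum_const, Finset.card_range, smul_eq_mul,
      ← Finset.mul_sum]
    simp only [Finset.card_filter, le_refl]
  nlinarith

end ComparisonAlgorithm

theorem exists_strictMonoOn_Iio {n : ℕ} {U : Type*} [LinearOrder U] (hn : 0 < n)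
    (hU : (n : ℕ∞) ≤ ENat.card U) : ∃ f : ℕ → U, StrictMonoOn f (Set.Iio n) := by
  rw [← Set.encard_univ] at hU
  obtain ⟨t, -, ht⟩ := Set.exists_subset_encard_eq hU
  have hfin : t.Finite := Set.finite_of_encard_eq_coe ht
  have hcard : hfin.toFinset.card = n := by
    rw [hfin.encard_eq_coe_toFinset_card] at ht
    exact_mod_cast ht
  refine ⟨fun i => if h : i < n then hfin.toFinset.orderEmbOfFin hcard ⟨i, h⟩ else
    hfin.toFinset.orderEmbOfFin hcard ⟨0, hn⟩, fun i hi j hj hij => ?_⟩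
  simp only [Set.mem_Iio] at hi hj
  simp only [dif_pos hi, dif_pos hj]
  exact (hfin.toFinset.orderEmbOfFin hcard).strictMono hij

theorem IsMeasurableAlgorithm.integrable_space {n : ℕ} {Info Ω U : Type*} [MeasurableSpace Ω]
    [LinearOrder U] {A : Ω → ComparisonAlgorithm n Info} (hA : IsMeasurableAlgorithm A U)
    (P : Measure Ω) [IsProbabilityMeasure P] (x : Fin n → U) (t : ℕ) :
    Integrable (fun ω => ((A ω).space x t : ℝ)) P := by
  let _ : MeasurableSpace (Finset (Fin n)) := ⊤
  have h1 : Measurable fun ω => (A ω).memory x t := measurable_to_countable' fun S => hA.memory x t S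
  have h2 : Measurable fun S : Finset (Fin n) => ((S.image x).card : ℝ) := measurable_from_top
  refine Integrable.of_bound (h2.comp h1).aestronglyMeasurable n (Filter.Eventually.of_forall ?_)
  intro ω
  rw [Real.norm_natCast]
  exact_mod_cast Finset.card_image_le.trans (Finset.card_le_univ _ |>.trans_eq (Fintype.card_fin n))

theorem two_pow_le_of_le_logb {n j : ℕ} (hn : 0 < n) (h : (j : ℝ) ≤ Real.logb 2 n) : 2 ^ j ≤ n := by
  rw [Real.le_logb_iff_rpow_le one_lt_two (by exact_mod_cast hn), Real.rpow_natCast] at h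
  exact_mod_cast h

/-- If the parameters fit, some hard stream forces the algorithm to use much space. -/
theorem exists_space_ge {n k w m : ℕ} (hw : 3 ≤ w) (hk : 0 < k)
    (hwk : ((w * k : ℕ) : ℝ) ≤ Real.logb 2 n) (hn : 0 < n) {s : ℝ} (hs : 0 ≤ s)
    (hm : 4 * (2 * s / w + 1) ^ 2 ≤ m) {U : Type*} [LinearOrder U]
    (hU : (n : ℕ∞) ≤ ENat.card U) {Ω : Type*} [MeasurableSpace Ω] (P : Measure Ω)
    [IsProbabilityMeasure P] {Info : Type*} {A : Ω → ComparisonAlgorithm n Info}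
    (hA : IsMeasurableAlgorithm A U) {δ ε : ℝ}
    (hε : ε * Real.logb 2 n = s) (hsol : SolvesTopQuantiles P A U (Real.logb 2 n) ε δ) :
    ∃ (x : Fin n → U) (t : ℕ), t ≤ n ∧
      ((k : ℝ) - 1 - 2 * m - 4 * k * δ) / 2 ≤ ∫ ω, ((A ω).space x t : ℝ) ∂P := by
  classical
  by_contra! H
  have hpow : 2 ^ (w * k) ≤ n := two_pow_le_of_le_logb hn hwk
  have hlen : w * k * 2 ^ k ≤ n := by
    refine le_trans ?_ hpow
    obtain ⟨v, rfl⟩ : ∃ v, w = v + 2 := ⟨w - 2, by omega⟩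
    have h1 : (v + 2) * k ≤ 2 ^ ((v + 1) * k) := by
      have h2 : (v + 1) * k + 1 ≤ 2 ^ ((v + 1) * k) := Nat.lt_two_pow_self
      have h3 : 2 * ((v + 1) * k) ≤ 2 ^ ((v + 1) * k) := by
        obtain ⟨z, hz⟩ : ∃ z, (v + 1) * k = z + 1 := ⟨(v + 1) * k - 1, by
          have : 0 < (v + 1) * k := by positivity
          omega⟩
        rw [hz, pow_succ]
        have : z < 2 ^ z := Nat.lt_two_pow_self
        omega
      nlinarith
    calc (v + 2) * k * 2 ^ k ≤ 2 ^ ((v + 1) * k) * 2 ^ k := Nat.mul_le_mul_right _ h1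
      _ = 2 ^ ((v + 2) * k) := by rw [← pow_add]; congr 1; ring
  have huniv : 4 ^ k < n := by
    refine lt_of_lt_of_le ?_ hpow
    rw [show 4 = 2 ^ 2 by norm_num, ← pow_mul]
    exact Nat.pow_lt_pow_right (by norm_num) (Nat.mul_lt_mul_of_pos_right (by omega) hk)
  obtain ⟨f, hf⟩ := exists_strictMonoOn_Iio hn hU
  have hx : ∀ b l p, treeStream n k w b l p ∈ Set.Iio n := fun b l p =>
    (treeStream_le k w b l p).trans_lt huniv
  have hy : ∀ b l, nodeKey k b 0 l ∈ Set.Iio n := fun b l => (nodeKey_lt k b 0 l).trans huniv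
  set B := (Finset.range k ×ˢ Finset.range (2 ^ k)).powerset with hB
  have hBpos : 0 < B.card := Finset.card_pos.2 ⟨∅, Finset.empty_mem_powerset _⟩
  have hspace : ∀ b, ∀ l ∈ Finset.range (2 ^ k),
      Integrable (fun ω => ((A ω).space (treeStream n k w b (2 ^ k)) ((l + 1) * k * w) : ℝ)) P ∧
      ∫ ω, ((A ω).space (treeStream n k w b (2 ^ k)) ((l + 1) * k * w) : ℝ) ∂P <
        ((k : ℝ) - 1 - 2 * m - 4 * k * δ) / 2 := by
    intro b l hl
    have ht : (l + 1) * k * w ≤ n := by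
      refine le_trans ?_ hlen
      calc (l + 1) * k * w ≤ 2 ^ k * k * w :=
            Nat.mul_le_mul_right _ (Nat.mul_le_mul_right _ (Finset.mem_range.1 hl))
        _ = _ := by ring
    have h1 := H (f ∘ treeStream n k w b (2 ^ k)) _ ht
    have h2 := hA.integrable_space P (f ∘ treeStream n k w b (2 ^ k)) ((l + 1) * k * w)
    simp only [ComparisonAlgorithm.space_strictMonoOn_comp hf _ (hx b _)] at h1 h2
    exact ⟨h2, h1⟩
  have hfail : ∀ b, ∀ l ∈ Finset.range (2 ^ k),
      Integrable (fun ω => if (A ω).Fails k w s l b then (1 : ℝ) else 0) P ∧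
      ∫ ω, (if (A ω).Fails k w s l b then (1 : ℝ) else 0) ∂P ≤ δ := by
    intro b l hl
    have hl' := Finset.mem_range.1 hl
    have h1 := hsol (f ∘ treeStream n k w b l) (f (nodeKey k b 0 l))
    have h2 := hA.answer (f ∘ treeStream n k w b l) (f (nodeKey k b 0 l))
    simp only [ComparisonAlgorithm.answer_strictMonoOn_comp hf _ (hx b _) (hy b l),
      streamRank_strictMonoOn_comp hf (hx b l) (hy b l), hε] at h1 h2
    have hrank : streamRank (treeStream n k w b l) (nodeKey k b 0 l) ≤ w * k := by
      rw [streamRank_treeStream (by omega) hlen hl']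
      refine Nat.mul_le_mul_left _ ((Finset.card_filter_le _ _).trans ?_)
      rw [Nat.card_Ico]
      omega
    have h3 := h1 (le_trans (by exact_mod_cast hrank) hwk)
    have h4 : MeasurableSet {ω | (A ω).Fails k w s l b} :=
      measurableSet_lt measurable_const ((measurable_const.sub h2).abs)
    have h5 : (fun ω => if (A ω).Fails k w s l b then (1 : ℝ) else 0) =
        {ω | (A ω).Fails k w s l b}.indicator fun _ => 1 := by
      funext ω
      simp [Set.indicator_apply]
    rw [h5]
    refine ⟨(integrable_const _).indicator h4, ?_⟩
    rw [integral_indicator_const _ h4, smul_eq_mul, mul_one]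
    exact h3
  have hpt : ∀ ω, ((B.card * 2 ^ k : ℕ) : ℝ) * ((k : ℝ) - 1 - 2 * m) ≤
      ∑ b ∈ B, ∑ l ∈ Finset.range (2 ^ k),
        (2 * ((A ω).space (treeStream n k w b (2 ^ k)) ((l + 1) * k * w) : ℝ) +
          4 * k * (if (A ω).Fails k w s l b then (1 : ℝ) else 0)) := by
    intro ω
    have h1 := (A ω).space_failure_tradeoff (by omega : 0 < w) hk hlen hs hm hB
    have h2 := (Nat.cast_le (α := ℝ)).2 h1
    simp only [Finset.sum_add_distrib, ← Finset.mul_sum]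
    push_cast [Nat.cast_sub (Nat.succ_le_of_lt hk)] at h2 ⊢
    linarith
  have hint : ∀ b ∈ B, ∀ l ∈ Finset.range (2 ^ k), Integrable (fun ω =>
      (2 * ((A ω).space (treeStream n k w b (2 ^ k)) ((l + 1) * k * w) : ℝ) +
          4 * k * (if (A ω).Fails k w s l b then (1 : ℝ) else 0))) P := fun b _ l hl =>
    ((hspace b l hl).1.const_mul 2).add ((hfail b l hl).1.const_mul (4 * (k : ℝ)))
  have hmean := integral_mono (integrable_const _)
    (integrable_finsetSum _ fun b hb => integrable_finsetSum _ (hint b hb)) hpt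
  rw [integral_const, probReal_univ, one_smul,
    integral_finsetSum _ fun b hb => integrable_finsetSum _ (hint b hb)] at hmean
  have hlt : ∑ b ∈ B, ∫ ω, ∑ l ∈ Finset.range (2 ^ k),
        (2 * ((A ω).space (treeStream n k w b (2 ^ k)) ((l + 1) * k * w) : ℝ) +
          4 * k * (if (A ω).Fails k w s l b then (1 : ℝ) else 0)) ∂P <
      ∑ _b ∈ B, ∑ _l ∈ Finset.range (2 ^ k), ((k : ℝ) - 1 - 2 * m) := by
    refine Finset.sum_lt_sum_of_nonempty (Finset.card_pos.1 hBpos) fun b hb => ?_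
    rw [integral_finsetSum _ (hint b hb)]
    refine Finset.sum_lt_sum_of_nonempty ⟨0, by simp⟩ fun l hl => ?_
    rw [integral_add ((hspace b l hl).1.const_mul 2) ((hfail b l hl).1.const_mul (4 * (k : ℝ))),
      integral_const_mul, integral_const_mul]
    have h1 := (hspace b l hl).2
    have h2 := mul_le_mul_of_nonneg_left (hfail b l hl).2 (by positivity : (0 : ℝ) ≤ 4 * k)
    linarith
  simp only [Finset.sum_const, Finset.card_range, nsmul_eq_mul] at hlt
  push_cast at hmean hlt
  linarith

theorem mainTheorem3 :
    ∃ c : ℝ, 0 < c ∧ ∃ N : ℕ, ∀ n : ℕ, N ≤ n →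
      ∀ (U : Type*) [LinearOrder U], (n : ℕ∞) ≤ ENat.card U →
      ∀ (Ω : Type*) [MeasurableSpace Ω] (P : Measure Ω) [IsProbabilityMeasure P]
        (Info : Type*) (A : Ω → ComparisonAlgorithm n Info),
        IsMeasurableAlgorithm A U →
      ∀ δ : ℝ, δ < 1 / 10 →
        SolvesTopQuantiles P A U (Real.logb 2 n) (1 / √(Real.logb 2 n)) δ →
        ∃ (x : Fin n → U) (t : ℕ), t ≤ n ∧
          c * Real.logb 2 n ≤ ∫ ω, ((A ω).space x t : ℝ) ∂P := by
  have hlog : Filter.Tendsto (fun n : ℕ => Real.logb 2 n) Filter.atTop Filter.atTop :=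
    (Real.tendsto_logb_atTop one_lt_two).comp tendsto_natCast_atTop_atTop
  obtain ⟨N, hN⟩ := Filter.eventually_atTop.1 (hlog.eventually_ge_atTop 100000000)
  refine ⟨1 / 40000, by norm_num, max N 1, fun n hn U _ hU Ω _ P _ Info A hA δ hδ hsol => ?_⟩
  have hR := hN n (le_of_max_le_left hn)
  have hn0 : 0 < n := le_of_max_le_right hn
  set R := Real.logb 2 n with hRdef
  have hR0 : 0 ≤ R := by linarith
  obtain ⟨k, hkdef⟩ : ∃ k, k = ⌊R / 2000⌋₊ := ⟨_, rfl⟩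
  have hk1 : (k : ℝ) ≤ R / 2000 := hkdef ▸ Nat.floor_le (by positivity)
  have hk2 : R / 2000 < k + 1 := hkdef ▸ Nat.lt_floor_add_one _
  have hk0 : 0 < k := by
    have : (0 : ℝ) < k := by linarith
    exact_mod_cast this
  obtain ⟨m, hmdef⟩ : ∃ m, m = k / 10 := ⟨_, rfl⟩
  have hm1 : (10 * m : ℝ) ≤ k := by exact_mod_cast (by omega : 10 * m ≤ k)
  have hm2 : (k : ℝ) ≤ 10 * m + 9 := by exact_mod_cast (by omega : k ≤ 10 * m + 9)
  have hsq : √R * √R = R := Real.mul_self_sqrt hR0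
  have hs1 : 10000 ≤ √R := Real.le_sqrt_of_sq_le (by norm_num; linarith)
  obtain ⟨x, t, ht, h⟩ := exists_space_ge (w := 2000) (m := m) (s := √R) (by norm_num) hk0
    (by push_cast; linarith) hn0 (Real.sqrt_nonneg _) (by push_cast; nlinarith) hU P hA
    (by rw [← hRdef]; field_simp; rw [sq, hsq]) hsol
  refine ⟨x, t, ht, le_trans ?_ h⟩
  have : (k : ℝ) * δ ≤ k * (1 / 10) := by gcongr
  linarith
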